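/- Let $n\ge 1$ and let $A$ be a complex $n\times n$ matrix with $\|A\|\le 1$, where $\|\cdot\|$ denotes the spectral norm (the operator norm induced by the Euclidean norm). Let $m=\prod_{i=1}^{|m|}(z-\lambda_i)$ be the minimal polynomial of $A$, of degree $|m|$, its roots $\lambda_i$ being repeated according to multiplicity, and let $M_{|m|}$ be the $|m|\times|m|$ lower-triangular Toeplitz matrix whose entries are $1$ on the diagonal, $2$ below it and $0$ above it. (1) Suppose that the spectrum $\sigma(A)$ is contained in the open unit disk. Then for every $\zeta\in\mathbb{C}\setminus\sigma(A)$ with $|\zeta|\le 1$, $$\|(\zeta-A)^{-1}\|\le\frac{\|M_{|m|}\|}{\min_{\lambda\in\sigma(A)}|1-\bar\lambda\zeta|}\cdot\frac{1}{|B(\zeta)|},\qquad B(\zeta)=\prod_{i=1}^{|m|}\frac{\zeta-\lambda_i}{1-\bar\lambda_i\zeta}.$$ (2) If $1\notin\sigma(A)$ (where $\sigma(A)$ need not be contained in the open unit disk), then $$\|(1-A)^{-1}\|\le\frac{\|M_{|m|}\|}{\min_{\lambda\in\sigma(A)}|1-\lambda|}.$$ This is the Davies–Simon bound, with a matrix of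 size $|m|$ in place of $n$. -/

import Mathlib

/- The norm of a complex matrix is its spectral norm, i.e. the operator norm with respect to the
Euclidean norm on vectors. -/
open scoped Matrix.Norms.L2Operator ComplexConjugate

/-- The `k × k` lower-triangular Toeplitz matrix with `1` on the diagonal and `2` below it. -/
def toeplitzM (k : ℕ) : Matrix (Fin k) (Fin k) ℂ :=
  Matrix.of fun i j => if i < j then 0 else if i = j then 1 else 2

/-- The Blaschke product associated with the minimal polynomial of `A`, evaluated at `z`: the
product of `(z - a) / (1 - conj a * z)` over the roots `a` of the minimal polynomial of `A`,
counted with multiplicity. -/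
noncomputable def blaschke {n : ℕ} (A : Matrix (Fin n) (Fin n) ℂ) (z : ℂ) : ℂ :=
  ((minpoly ℂ A).roots.map fun a => (z - a) / (1 - conj a * z)).prod

/-- The quantity `min |1 - conj a * z|` over the eigenvalues `a` of `A`. The set of eigenvalues
is finite, and nonempty if `0 < n`, so that the infimum is then a minimum. -/
noncomputable def minDist {n : ℕ} (A : Matrix (Fin n) (Fin n) ℂ) (z : ℂ) : ℝ :=
  sInf ((fun a : ℂ => ‖1 - conj a * z‖) '' spectrum ℂ A)

/-! It suffices to bound the resolvent on each vector `x`. The cyclic subspace generated by `x` is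
`A`-invariant, and there the characteristic and minimal polynomials coincide, so its dimension is at
most |m|. By Schur, `A` acts on it as a lower-triangular contraction `L` whose diagonal is a
submultiset of the roots of m. For such `L` put D = (1 - L)⁻¹. Then D + D* - 1 = D(1 - LL*)D* is
positive semidefinite, so its 2 × 2 minors bound the off-diagonal entries of D by the diagonal ones,
and D is dominated entrywise by `toeplitzM` divided by the minimum distance. This gives (2). For
(1), factor (ζ - L)⁻¹ = (1 - ζ̄L)⁻¹T⁻¹ with T = (ζ - L)(1 - ζ̄L)⁻¹. The first factor is covered by
the previous bound; T is a contraction, so ‖T⁻¹‖ ≤ 1/|det T|, and |det T| is the modulus of the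
Blaschke product of `L`. Passing to all roots of m only shrinks that product. -/

/-! ### Spectral norm: entrywise domination and compressions -/

open Matrix in
theorem norm_toLp_mulVec_le {m n : ℕ} (A : Matrix (Fin m) (Fin n) ℂ) (x : Fin n → ℂ) :
    ‖WithLp.toLp 2 (A *ᵥ x)‖ ≤ ‖A‖ * ‖WithLp.toLp 2 x‖ :=
  A.l2_opNorm_mulVec (WithLp.toLp 2 x)

open Matrix in
theorem l2_opNorm_le_bound {m n : ℕ} (A : Matrix (Fin m) (Fin n) ℂ) {c : ℝ} (hc : 0 ≤ c)
    (h : ∀ x : Fin n → ℂ, ‖WithLp.toLp 2 (A *ᵥ x)‖ ≤ c * ‖WithLp.toLp 2 x‖) : ‖A‖ ≤ c :=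
  ContinuousLinearMap.opNorm_le_bound _ hc fun x => h x.ofLp

open Matrix in
theorem star_dotProduct_self {m : ℕ} (y : Fin m → ℂ) :
    star y ⬝ᵥ y = ((‖WithLp.toLp 2 y‖ ^ 2 : ℝ) : ℂ) := by
  rw [EuclideanSpace.norm_sq_eq]
  simp [dotProduct, Complex.conj_mul']

theorem norm_toLp_le_of_forall_le {m : ℕ} {x y : Fin m → ℂ} (h : ∀ i, ‖x i‖ ≤ ‖y i‖) :
    ‖WithLp.toLp 2 x‖ ≤ ‖WithLp.toLp 2 y‖ := by
  rw [EuclideanSpace.norm_eq, EuclideanSpace.norm_eq]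
  gcongr with i
  exact h i

/-- The spectral norm is monotone in the absolute values of the entries. -/
theorem l2_opNorm_le_of_norm_entry_le {m n : ℕ} {A : Matrix (Fin m) (Fin n) ℂ}
    {B : Matrix (Fin m) (Fin n) ℝ} (h : ∀ i j, ‖A i j‖ ≤ B i j) :
    ‖A‖ ≤ ‖B.map (fun b => (b : ℂ))‖ := by
  refine l2_opNorm_le_bound A (norm_nonneg _) fun x => ?_
  have h1 := norm_toLp_mulVec_le (B.map (fun b => (b : ℂ))) fun j => (‖x j‖ : ℂ)
  have h2 : ‖WithLp.toLp 2 fun j => (‖x j‖ : ℂ)‖ = ‖WithLp.toLp 2 x‖ := by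
    simp [EuclideanSpace.norm_eq]
  rw [h2] at h1
  refine le_trans (norm_toLp_le_of_forall_le fun i => ?_) h1
  have h3 : (B.map (fun b => (b : ℂ))).mulVec (fun j => (‖x j‖ : ℂ)) i
      = ((∑ j, B i j * ‖x j‖ : ℝ) : ℂ) := by
    simp [Matrix.mulVec, dotProduct]
  rw [h3, Complex.norm_real]
  refine le_trans ?_ (le_abs_self _)
  rw [Matrix.mulVec, dotProduct]
  refine (norm_sum_le _ _).trans (Finset.sum_le_sum fun j _ => ?_)
  rw [norm_mul]
  exact mul_le_mul_of_nonneg_right (h i j) (norm_nonneg _)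

theorem norm_le_one_of_conjTranspose_mul_self {m n : ℕ} {V : Matrix (Fin m) (Fin n) ℂ}
    (h : V.conjTranspose * V = 1) : ‖V‖ ≤ 1 := by
  have h1 := Matrix.l2_opNorm_conjTranspose_mul_self V
  have h2 : ‖(1 : Matrix (Fin n) (Fin n) ℂ)‖ ≤ 1 := by
    refine l2_opNorm_le_bound _ zero_le_one fun x => ?_
    simp
  rw [h] at h1
  nlinarith [norm_nonneg V]

/-- The smaller matrix is a corner of the larger one. This is needed because a cyclic subspace may
have dimension less than |m|. -/
theorem norm_toeplitzM_mono {k N : ℕ} (h : k ≤ N) : ‖toeplitzM k‖ ≤ ‖toeplitzM N‖ := by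
  let S : Matrix (Fin N) (Fin k) ℂ := (1 : Matrix (Fin N) (Fin N) ℂ).submatrix id (Fin.castLE h)
  have hr (B : Matrix (Fin N) (Fin N) ℂ) : B * S = B.submatrix id (Fin.castLE h) := by
    ext i j
    simp [S, Matrix.mul_apply, Matrix.one_apply]
  have hl (B : Matrix (Fin N) (Fin k) ℂ) :
      S.conjTranspose * B = B.submatrix (Fin.castLE h) id := by
    ext i j
    simp [S, Matrix.mul_apply, Matrix.one_apply]
  have hS : S.conjTranspose * S = 1 := by
    rw [hl]
    ext i j
    simp [S, Matrix.one_apply]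
  have hM : toeplitzM k = S.conjTranspose * toeplitzM N * S := by
    rw [Matrix.mul_assoc, hr, hl]
    ext i j
    simp [toeplitzM]
  have h1 := norm_le_one_of_conjTranspose_mul_self hS
  have h2 : ‖S.conjTranspose‖ ≤ 1 := by rwa [Matrix.l2_opNorm_conjTranspose]
  rw [hM]
  calc _ ≤ ‖S.conjTranspose‖ * ‖toeplitzM N‖ * ‖S‖ :=
        (Matrix.l2_opNorm_mul _ _).trans (by gcongr; exact Matrix.l2_opNorm_mul _ _)
    _ ≤ 1 * ‖toeplitzM N‖ * 1 := by gcongr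
    _ = _ := by ring

/-! ### Inverses of contractions -/

open Matrix ComplexOrder in
theorem posSemidef_one_sub_mul_conjTranspose {k : ℕ} {L : Matrix (Fin k) (Fin k) ℂ}
    (hL : ‖L‖ ≤ 1) : (1 - L * Lᴴ).PosSemidef := by
  refine Matrix.posSemidef_iff_dotProduct_mulVec.2 ⟨?_, fun x => ?_⟩
  · simp [Matrix.IsHermitian]
  · have h1 := norm_toLp_mulVec_le Lᴴ x
    rw [Matrix.l2_opNorm_conjTranspose] at h1
    have h2 : ‖WithLp.toLp 2 (Lᴴ *ᵥ x)‖ ≤ ‖WithLp.toLp 2 x‖ :=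
      h1.trans (mul_le_of_le_one_left (norm_nonneg _) hL)
    have h3 : star x ⬝ᵥ (1 - L * Lᴴ) *ᵥ x = star x ⬝ᵥ x - star (Lᴴ *ᵥ x) ⬝ᵥ (Lᴴ *ᵥ x) := by
      rw [Matrix.sub_mulVec, Matrix.one_mulVec, dotProduct_sub, star_mulVec,
        ← Matrix.dotProduct_mulVec, Matrix.mulVec_mulVec, Matrix.conjTranspose_conjTranspose]
    rw [h3, star_dotProduct_self, star_dotProduct_self, ← Complex.ofReal_sub, Complex.zero_le_real]
    have := norm_nonneg (WithLp.toLp 2 (Lᴴ *ᵥ x))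
    nlinarith

open ComplexOrder in
theorem Matrix.PosSemidef.norm_entry_sq_le {k : ℕ} {P : Matrix (Fin k) (Fin k) ℂ}
    (hP : P.PosSemidef) (i j : Fin k) : ‖P i j‖ ^ 2 ≤ (P i i).re * (P j j).re := by
  have h := (hP.submatrix ![i, j]).det_nonneg
  rw [Matrix.det_fin_two] at h
  have hij : P j i = conj (P i j) := (hP.1.apply j i).symm
  have hi : P i i = ((P i i).re : ℂ) := (hP.1.coe_re_apply_self i).symm
  have hj : P j j = ((P j j).re : ℂ) := (hP.1.coe_re_apply_self j).symm
  simp only [Matrix.submatrix_apply, Matrix.cons_val_zero, Matrix.cons_val_one] at h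
  rw [hij, Complex.mul_conj', hi, hj] at h
  have h' : ((0 : ℝ) : ℂ) ≤ (((P i i).re * (P j j).re - ‖P i j‖ ^ 2 : ℝ) : ℂ) := by
    push_cast; exact h
  have := Complex.real_le_real.1 h'
  linarith

open Matrix in
/-- The inverse of a contraction has norm at most the inverse modulus of the determinant. -/
theorem norm_inv_le_of_norm_le_one {k : ℕ} {T : Matrix (Fin k) (Fin k) ℂ} (hT : ‖T‖ ≤ 1)
    (hdet : T.det ≠ 0) : ‖T⁻¹‖ ≤ 1 / ‖T.det‖ := by
  have hP : (Tᴴ * T).IsHermitian := Matrix.isHermitian_conjTranspose_mul_self T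
  set μ := hP.eigenvalues with hμ
  have hPn : ‖Tᴴ * T‖ ≤ 1 := by
    rw [Matrix.l2_opNorm_conjTranspose_mul_self]
    nlinarith [norm_nonneg T]
  have hprod : ∏ i, μ i = ‖T.det‖ ^ 2 := by
    have h1 := hP.det_eq_prod_eigenvalues
    rw [Matrix.det_mul, Matrix.det_conjTranspose, Complex.star_def, Complex.conj_mul'] at h1
    refine Complex.ofReal_injective ?_
    rw [Complex.ofReal_prod, Complex.ofReal_pow]
    exact h1.symm
  have hμ0 (i) : 0 ≤ μ i := Matrix.eigenvalues_conjTranspose_mul_self_nonneg T i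
  have hμ1 (i) : μ i ≤ 1 := by
    have hv := norm_toLp_mulVec_le (Tᴴ * T) (hP.eigenvectorBasis i).ofLp
    rw [hP.mulVec_eigenvectorBasis] at hv
    have h2 : ‖hP.eigenvectorBasis i‖ = 1 := hP.eigenvectorBasis.orthonormal.1 i
    have h3 : ‖WithLp.toLp 2 (hP.eigenvalues i • (hP.eigenvectorBasis i).ofLp)‖ = μ i := by
      rw [WithLp.toLp_smul, norm_smul, WithLp.toLp_ofLp, h2, mul_one, Real.norm_eq_abs,
        abs_of_nonneg (hμ0 i)]
    rw [h3, WithLp.toLp_ofLp, h2] at hv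
    linarith
  have hpos : 0 < ∏ i, μ i := by rw [hprod]; positivity
  have hμpos (i) : 0 < μ i :=
    lt_of_le_of_ne (hμ0 i) fun h => hpos.ne' (Finset.prod_eq_zero (Finset.mem_univ i) h.symm)
  -- The squared singular values lie in [0, 1], so even the smallest is at least their product |det
  -- T|².
  have hle (i) : ∏ j, μ j ≤ μ i := by
    rw [← Finset.mul_prod_erase _ _ (Finset.mem_univ i)]
    exact mul_le_of_le_one_right (hμ0 i) (Finset.prod_le_one (fun j _ => hμ0 j) fun j _ => hμ1 j)
  have hbound (x : Fin k → ℂ) :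
      ‖T.det‖ * ‖WithLp.toLp 2 x‖ ≤ ‖WithLp.toLp 2 (T *ᵥ x)‖ := by
    set b := hP.eigenvectorBasis
    set u := WithLp.toLp 2 x
    have hx : ∑ i, ‖inner ℂ (b i) u‖ ^ 2 = ‖u‖ ^ 2 := b.sum_sq_norm_inner_right u
    have hq : ‖WithLp.toLp 2 (T *ᵥ x)‖ ^ 2 = ∑ i, μ i * ‖inner ℂ (b i) u‖ ^ 2 := by
      have h1 : ((‖WithLp.toLp 2 (T *ᵥ x)‖ ^ 2 : ℝ) : ℂ) =
          inner ℂ u (toEuclideanLin (Tᴴ * T) u) := by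
        rw [← star_dotProduct_self, star_mulVec, ← Matrix.dotProduct_mulVec, Matrix.mulVec_mulVec,
          EuclideanSpace.inner_eq_star_dotProduct, dotProduct_comm]
        rfl
      have h2 (i) : inner ℂ (b i) (toEuclideanLin (Tᴴ * T) u) = μ i * inner ℂ (b i) u := by
        have hs : (toEuclideanLin (Tᴴ * T)).IsSymmetric :=
          Matrix.isSymmetric_toEuclideanLin_iff.2 hP
        have hb : toEuclideanLin (Tᴴ * T) (b i) = (μ i : ℂ) • b i := by
          have := hP.mulVec_eigenvectorBasis i
          rw [Matrix.toLpLin_apply, this]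
          rfl
        rw [← hs, hb, inner_smul_left, Complex.conj_ofReal]
      have h3 : ((‖WithLp.toLp 2 (T *ᵥ x)‖ ^ 2 : ℝ) : ℂ)
          = ((∑ i, μ i * ‖inner ℂ (b i) u‖ ^ 2 : ℝ) : ℂ) := by
        rw [h1, ← b.sum_inner_mul_inner, Complex.ofReal_sum]
        refine Finset.sum_congr rfl fun i _ => ?_
        rw [h2, mul_left_comm, ← inner_conj_symm u (b i), Complex.conj_mul']
        push_cast
        rfl
      exact_mod_cast h3
    refine le_of_sq_le_sq ?_ (norm_nonneg _)
    rw [mul_pow, ← hprod, hq, ← hx, Finset.mul_sum]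
    gcongr with i
    exact hle i
  have hu : IsUnit T.det := isUnit_iff_ne_zero.2 hdet
  refine l2_opNorm_le_bound _ (by positivity) fun y => ?_
  have h := hbound (T⁻¹ *ᵥ y)
  rw [Matrix.mulVec_mulVec, Matrix.mul_nonsing_inv _ hu, Matrix.one_mulVec] at h
  have : 0 < ‖T.det‖ := norm_pos_iff.2 hdet
  rw [div_mul_eq_mul_div, one_mul, le_div_iff₀ this]
  linarith

open ComplexOrder in
/-- Davies–Simon bound for a triangular contraction. -/
theorem norm_one_sub_inv_le_of_triangular {k : ℕ} {L : Matrix (Fin k) (Fin k) ℂ} (hL : ‖L‖ ≤ 1)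
    (ht : ∀ i j, i < j → L i j = 0) {d : ℝ} (hd : 0 < d) (h : ∀ i, d ≤ ‖1 - L i i‖) :
    ‖(1 - L)⁻¹‖ ≤ ‖toeplitzM k‖ / d := by
  have hlt : (1 - L).IsLowerTriangular := by
    intro i j hij
    have hij' : i < j := hij
    simp [ht i j hij', hij'.ne]
  have hdet : IsUnit (1 - L).det := by
    rw [Matrix.det_of_isLowerTriangular _ hlt, isUnit_iff_ne_zero, Finset.prod_ne_zero_iff]
    intro i _
    rw [Matrix.sub_apply, Matrix.one_apply_eq, ← norm_pos_iff]
    exact hd.trans_le (h i)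
  have := Matrix.invertibleOfIsUnitDet _ hdet
  set D := (1 - L)⁻¹ with hD
  have hDt (i j) (hij : i < j) : D i j = 0 := Matrix.blockTriangular_inv_of_blockTriangular hlt hij
  have hmul : (1 - L) * D = 1 := Matrix.mul_nonsing_inv _ hdet
  have hmul' : D * (1 - L) = 1 := Matrix.nonsing_inv_mul _ hdet
  have hDii (i) : (1 - L i i) * D i i = 1 := by
    have h1 := congrFun (congrFun hmul i) i
    rw [Matrix.mul_apply, Finset.sum_eq_single i, Matrix.one_apply_eq, Matrix.sub_apply,
      Matrix.one_apply_eq] at h1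
    · exact h1
    · intro j _ hj
      rcases lt_or_gt_of_ne hj with hj | hj
      · rw [hDt j i hj, mul_zero]
      · have : (1 - L) i j = 0 := hlt hj
        rw [this, zero_mul]
    · simp
  have hDn (i) : ‖D i i‖ ≤ 1 / d := by
    have h1 := congrArg norm (hDii i)
    rw [norm_mul, norm_one] at h1
    rw [le_div_iff₀ hd]
    nlinarith [h i, norm_nonneg (D i i)]
  -- The key identity, from DL = D - 1 and its adjoint; it is where contractivity enters.
  have hP : (D + D.conjTranspose - 1) = D * (1 - L * L.conjTranspose) * D.conjTranspose := by
    have hc : (1 - L.conjTranspose) * D.conjTranspose = 1 := by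
      have := congrArg Matrix.conjTranspose hmul'
      simpa using this
    have e1 : D * L = D - 1 := by
      rw [Matrix.mul_sub, Matrix.mul_one] at hmul'
      rw [← hmul']; abel
    have e2 : L.conjTranspose * D.conjTranspose = D.conjTranspose - 1 := by
      rw [← Matrix.conjTranspose_mul, e1]; simp
    rw [Matrix.mul_sub, Matrix.sub_mul, Matrix.mul_one, Matrix.mul_assoc, Matrix.mul_assoc,
      e2, ← Matrix.mul_assoc, e1]
    noncomm_ring
  have hPsd : (D + D.conjTranspose - 1).PosSemidef := by
    rw [hP]
    exact (posSemidef_one_sub_mul_conjTranspose hL).mul_mul_conjTranspose_same D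
  have hPdiag (i) : ((D + D.conjTranspose - 1) i i).re ≤ 2 / d := by
    have h1 := Complex.re_le_norm (D i i)
    have h2 := hDn i
    have h3 : 2 / d = 1 / d + 1 / d := by ring
    simp only [Matrix.sub_apply, Matrix.add_apply, Matrix.conjTranspose_apply, Matrix.one_apply_eq,
      Complex.sub_re, Complex.add_re, Complex.star_def, Complex.conj_re, Complex.one_re]
    linarith
  -- Below the diagonal D* and 1 vanish, so the positive matrix has the same entry as D there.
  have hoff (i j) (hij : j < i) : ‖D i j‖ ≤ 2 / d := by
    have h1 := hPsd.norm_entry_sq_le i j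
    have h2 : (D + D.conjTranspose - 1) i j = D i j := by
      simp [hij.ne', hDt j i hij]
    rw [h2] at h1
    have h0 (i) : 0 ≤ ((D + D.conjTranspose - 1) i i).re :=
      (Complex.nonneg_iff.1 (hPsd.diag_nonneg (i := i))).1
    refine le_of_sq_le_sq (h1.trans ?_) (by positivity)
    rw [sq]
    exact mul_le_mul (hPdiag i) (hPdiag j) (h0 j) (by positivity)
  let B : Matrix (Fin k) (Fin k) ℝ :=
    Matrix.of fun i j => if i < j then 0 else if i = j then 1 / d else 2 / d
  have hB : ‖D‖ ≤ ‖B.map (fun b => (b : ℂ))‖ := by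
    refine l2_opNorm_le_of_norm_entry_le fun i j => ?_
    rcases lt_trichotomy i j with hij | rfl | hij
    · simp [B, hij, hDt i j hij]
    · simpa [B] using hDn i
    · simpa [B, hij.not_gt, hij.ne'] using hoff i j hij
  have hBM : B.map (fun b => (b : ℂ)) = ((1 / d : ℝ) : ℂ) • toeplitzM k := by
    ext i j
    simp only [B, toeplitzM, Matrix.map_apply, Matrix.of_apply, Matrix.smul_apply, smul_eq_mul]
    split_ifs <;> push_cast <;> ring
  rw [hBM, norm_smul, Complex.norm_real, Real.norm_eq_abs, abs_of_pos (by positivity)] at hB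
  rw [div_eq_inv_mul, ← one_div]
  exact hB

/-! ### Triangularization on cyclic subspaces -/

/-- Schur's theorem: an endomorphism of a finite-dimensional complex inner product space is lower
triangular in a suitable orthonormal basis. -/
theorem exists_orthonormalBasis_triangular : ∀ (n : ℕ) {E : Type} [NormedAddCommGroup E]
    [InnerProductSpace ℂ E] [FiniteDimensional ℂ E] (_ : Module.finrank ℂ E = n) (T : E →ₗ[ℂ] E),
    ∃ b : OrthonormalBasis (Fin n) ℂ E, ∀ i j, i < j → inner ℂ (b i) (T (b j)) = 0
  | 0, E, _, _, _, hE, T =>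
    ⟨(stdOrthonormalBasis ℂ E).reindex (finCongr hE), fun i => i.elim0⟩
  | n + 1, E, _, _, _, hE, T => by
    have : Nontrivial E := Module.nontrivial_of_finrank_eq_succ hE
    -- An eigenvector of the adjoint has a T-invariant orthogonal complement; placing it first makes
    -- the matrix lower, not upper, triangular.
    obtain ⟨c, hc⟩ := Module.End.exists_eigenvalue T.adjoint
    obtain ⟨w, hw⟩ := hc.exists_hasEigenvector
    obtain ⟨v, hv1, hv⟩ : ∃ v : E, ‖v‖ = 1 ∧ T.adjoint v = c • v := by
      refine ⟨((‖w‖⁻¹ : ℝ) : ℂ) • w, ?_, ?_⟩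
      · rw [norm_smul, Complex.norm_real, norm_inv, norm_norm,
          inv_mul_cancel₀ (norm_ne_zero_iff.2 hw.2)]
      · rw [map_smul, hw.apply_eq_smul, smul_comm]
    have hv0 : v ≠ 0 := by rintro rfl; simp at hv1
    let W : Submodule ℂ E := (ℂ ∙ v)ᗮ
    have hT : ∀ u ∈ W, T u ∈ W := fun u hu => by
      rw [Submodule.mem_orthogonal_singleton_iff_inner_right] at hu ⊢
      rw [← LinearMap.adjoint_inner_left, hv, inner_smul_left, hu, mul_zero]
    have hW : Module.finrank ℂ W = n :=
      have : Fact (Module.finrank ℂ E = n + 1) := ⟨hE⟩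
      Submodule.finrank_orthogonal_span_singleton hv0
    obtain ⟨b, hb⟩ := exists_orthonormalBasis_triangular n hW (T.restrict hT)
    let f : Fin (n + 1) → E := Fin.cons v fun i => (b i : E)
    have hvb (u : W) : inner ℂ v (u : E) = 0 :=
      Submodule.mem_orthogonal_singleton_iff_inner_right.1 u.2
    have hf : Orthonormal ℂ f := by
      rw [orthonormal_iff_ite]
      intro i j
      refine Fin.cases ?_ (fun i => ?_) i <;> refine Fin.cases ?_ (fun j => ?_) j
      · simp [f, hv1]
      · simp [f, hvb, (Fin.succ_ne_zero _).symm]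
      · have := inner_eq_zero_symm.1 (hvb (b i))
        simp [f, this]
      · simpa [f] using orthonormal_iff_ite.1 b.orthonormal i j
    let B := basisOfOrthonormalOfCardEqFinrank hf (by simp [hE])
    have hB : ⇑B = f := coe_basisOfOrthonormalOfCardEqFinrank _ _
    refine ⟨B.toOrthonormalBasis (by rwa [hB]), fun i j hij => ?_⟩
    rw [Module.Basis.coe_toOrthonormalBasis, hB]
    obtain ⟨j, rfl⟩ := Fin.exists_succ_eq.2 (Fin.ne_zero_of_lt hij)
    revert hij
    refine Fin.cases (fun _ => ?_) (fun i hij => ?_) i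
    · exact hvb ⟨T (b j), hT _ (b j).2⟩
    · exact hb i j (Fin.succ_lt_succ_iff.1 hij)

open Polynomial in
/-- The restriction of an endomorphism to a cyclic subspace has a characteristic polynomial that
divides the minimal polynomial of the endomorphism. -/
theorem exists_invariant_submodule_charpoly_dvd_minpoly {E : Type} [AddCommGroup E] [Module ℂ E]
    [FiniteDimensional ℂ E] (T : E →ₗ[ℂ] E) (x : E) :
    ∃ (W : Submodule ℂ E) (hW : ∀ u ∈ W, T u ∈ W), x ∈ W ∧
      (T.restrict hW).charpoly ∣ minpoly ℂ T := by
  let φ : ℂ[X] →ₗ[ℂ] E := (LinearMap.applyₗ x).comp (aeval T).toLinearMap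
  have hφ (q : ℂ[X]) : φ q = aeval T q x := rfl
  let W := LinearMap.range φ
  have hW : ∀ u ∈ W, T u ∈ W := by
    rintro _ ⟨q, rfl⟩
    exact ⟨X * q, by simp [hφ]⟩
  have hx : x ∈ W := ⟨1, by simp [hφ]⟩
  have hres (q : ℂ[X]) (u : W) : ((aeval (T.restrict hW) q u : W) : E) = aeval T q (u : E) := by
    induction q using Polynomial.induction_on' with
    | add p q hp hq => simp [hp, hq]
    | monomial m a =>
      simp only [aeval_monomial, Module.algebraMap_end_eq_smul_id, Module.End.mul_apply,
        LinearMap.smul_apply, LinearMap.id_apply, Submodule.coe_smul]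
      rw [Module.End.pow_restrict m hW]
      rfl
  set p := minpoly ℂ (T.restrict hW)
  have hp : p.Monic := minpoly.monic (Algebra.IsIntegral.isIntegral _)
  have hpT : p ∣ minpoly ℂ T := by
    refine minpoly.dvd _ _ (LinearMap.ext fun u => Subtype.ext ?_)
    rw [hres, minpoly.aeval]
    rfl
  -- Since p(T)x = 0, remainders modulo p already yield all of W. Hence deg p ≥ dim W, which forces
  -- p to be the characteristic polynomial.
  have hle : Module.finrank ℂ W ≤ p.natDegree := by
    have hsub : W ≤ (degreeLT ℂ p.natDegree).map φ := by
      rintro _ ⟨q, rfl⟩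
      refine ⟨q %ₘ p, ?_, ?_⟩
      · rw [SetLike.mem_coe, mem_degreeLT, ← degree_eq_natDegree hp.ne_zero]
        exact degree_modByMonic_lt _ hp
      · have h1 := hres p ⟨x, hx⟩
        rw [minpoly.aeval] at h1
        have h2 : aeval T p x = 0 := h1.symm
        conv_rhs => rw [← modByMonic_add_div q p]
        rw [map_add, hφ (p * _), mul_comm, map_mul, Module.End.mul_apply, h2, map_zero, add_zero]
    have hfd : FiniteDimensional ℂ (degreeLT ℂ p.natDegree) :=
      (degreeLTEquiv ℂ p.natDegree).symm.finiteDimensional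
    calc Module.finrank ℂ W ≤ Module.finrank ℂ ((degreeLT ℂ p.natDegree).map φ) :=
          Submodule.finrank_mono hsub
      _ ≤ Module.finrank ℂ (degreeLT ℂ p.natDegree) := Submodule.finrank_map_le _ _
      _ = p.natDegree := by simp [(degreeLTEquiv ℂ p.natDegree).finrank_eq]
  refine ⟨W, hW, hx, ?_⟩
  have hpc : p ∣ (T.restrict hW).charpoly := LinearMap.minpoly_dvd_charpoly _
  have : (T.restrict hW).charpoly = p := by
    refine (eq_of_monic_of_dvd_of_natDegree_le hp (LinearMap.charpoly_monic _) hpc ?_)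
    rwa [LinearMap.charpoly_natDegree]
  rwa [this]

open Matrix in
theorem exists_isometry_triangular {n : ℕ} (A : Matrix (Fin n) (Fin n) ℂ) (x : Fin n → ℂ) :
    ∃ (k : ℕ) (V : Matrix (Fin n) (Fin k) ℂ) (L : Matrix (Fin k) (Fin k) ℂ) (y : Fin k → ℂ),
      Vᴴ * V = 1 ∧ A * V = V * L ∧ x = V *ᵥ y ∧ (∀ i j, i < j → L i j = 0) ∧
        L.charpoly ∣ minpoly ℂ A := by
  obtain ⟨W, hW, hx, hdvd⟩ :=
    exists_invariant_submodule_charpoly_dvd_minpoly (toEuclideanLin A) (WithLp.toLp 2 x)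
  obtain ⟨b, hb⟩ := exists_orthonormalBasis_triangular _ (E := W) rfl
    ((toEuclideanLin A).restrict hW)
  set g := (toEuclideanLin A).restrict hW
  have hsum (u : W) (i : Fin n) :
      (u : EuclideanSpace ℂ (Fin n)) i =
        ∑ j, (b j : EuclideanSpace ℂ (Fin n)) i * inner ℂ (b j) u := by
    conv_lhs => rw [← b.sum_repr' u]
    simp [mul_comm]
  refine ⟨_, Matrix.of fun i j => (b j : EuclideanSpace ℂ (Fin n)) i,
    Matrix.of fun i j => inner ℂ (b i) (g (b j)), fun j => inner ℂ (b j) ⟨_, hx⟩, ?_, ?_, ?_, hb, ?_⟩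
  · ext i j
    have h := orthonormal_iff_ite.1 b.orthonormal i j
    rw [Submodule.coe_inner, EuclideanSpace.inner_eq_star_dotProduct] at h
    rw [Matrix.one_apply, ← h, Matrix.mul_apply, dotProduct_comm]
    rfl
  · ext i j
    exact hsum (g (b j)) i
  · ext i
    exact hsum ⟨_, hx⟩ i
  · have h1 : (Matrix.of fun i j => inner ℂ (b i) (g (b j))) =
        LinearMap.toMatrix b.toBasis b.toBasis g := by
      ext i j
      simp [LinearMap.toMatrix_apply, b.repr_apply_apply]
    have h2 : minpoly ℂ (toEuclideanLin A) = minpoly ℂ A :=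
      Matrix.minpoly_toLin (PiLp.basisFun 2 ℂ (Fin n)) A
    rw [h1, LinearMap.charpoly_toMatrix, ← h2]
    exact hdvd

open Matrix in
theorem norm_toLp_isometry_mulVec {m k : ℕ} {V : Matrix (Fin m) (Fin k) ℂ} (hV : Vᴴ * V = 1)
    (y : Fin k → ℂ) : ‖WithLp.toLp 2 (V *ᵥ y)‖ = ‖WithLp.toLp 2 y‖ := by
  have h1 := norm_le_one_of_conjTranspose_mul_self hV
  refine le_antisymm ((norm_toLp_mulVec_le V y).trans
    (mul_le_of_le_one_left (norm_nonneg _) h1)) ?_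
  have h2 := norm_toLp_mulVec_le Vᴴ (V *ᵥ y)
  rw [Matrix.mulVec_mulVec, hV, Matrix.one_mulVec, Matrix.l2_opNorm_conjTranspose] at h2
  exact h2.trans (mul_le_of_le_one_left (norm_nonneg _) h1)

/-! ### Möbius transforms of triangular contractions -/

theorem det_smul_one_sub_of_triangular {k : ℕ} {L : Matrix (Fin k) (Fin k) ℂ}
    (ht : ∀ i j, i < j → L i j = 0) (a b : ℂ) :
    (a • (1 : Matrix (Fin k) (Fin k) ℂ) - b • L).det = ∏ i, (a - b * L i i) := by
  rw [Matrix.det_of_isLowerTriangular]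
  · simp
  · intro i j hij
    have hij' : i < j := hij
    simp [ht i j hij', hij'.ne]

open Polynomial in
theorem charpoly_of_triangular {k : ℕ} {L : Matrix (Fin k) (Fin k) ℂ}
    (ht : ∀ i j, i < j → L i j = 0) : L.charpoly = ∏ i, (X - C (L i i)) := by
  rw [← Matrix.charpoly_transpose, Matrix.charpoly_of_isUpperTriangular]
  · rfl
  · intro i j hij
    exact ht j i hij

open Polynomial in
theorem roots_charpoly_of_triangular {k : ℕ} {L : Matrix (Fin k) (Fin k) ℂ}
    (ht : ∀ i j, i < j → L i j = 0) :
    L.charpoly.roots = Finset.univ.val.map fun i => L i i := by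
  rw [charpoly_of_triangular ht, Finset.prod_eq_multiset_prod,
    ← roots_multiset_prod_X_sub_C (Finset.univ.val.map fun i => L i i), Multiset.map_map]
  rfl

theorem norm_smul_sub_le_norm_sub_smul {E : Type*} [NormedAddCommGroup E] [InnerProductSpace ℂ E]
    {u v : E} (h : ‖v‖ ≤ ‖u‖) {ζ : ℂ} (hζ : ‖ζ‖ ≤ 1) : ‖ζ • u - v‖ ≤ ‖u - conj ζ • v‖ := by
  refine le_of_sq_le_sq ?_ (norm_nonneg _)
  rw [@norm_sub_sq ℂ, @norm_sub_sq ℂ, inner_smul_left, inner_smul_right, norm_smul, norm_smul,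
    RCLike.norm_conj]
  -- This product is the difference of the two squared norms: the cross terms agree.
  have h1 : 0 ≤ (1 - ‖ζ‖ ^ 2) * (‖u‖ ^ 2 - ‖v‖ ^ 2) :=
    mul_nonneg (by nlinarith [norm_nonneg ζ]) (by nlinarith [norm_nonneg v])
  nlinarith

open Matrix in
theorem norm_mobius_le_one {k : ℕ} {L : Matrix (Fin k) (Fin k) ℂ} (hL : ‖L‖ ≤ 1) {ζ : ℂ}
    (hζ : ‖ζ‖ ≤ 1) (hdet : IsUnit (1 - conj ζ • L).det) :
    ‖(ζ • (1 : Matrix (Fin k) (Fin k) ℂ) - L) * (1 - conj ζ • L)⁻¹‖ ≤ 1 := by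
  refine l2_opNorm_le_bound _ zero_le_one fun x => ?_
  obtain ⟨y, rfl⟩ : ∃ y, x = (1 - conj ζ • L) *ᵥ y :=
    ⟨(1 - conj ζ • L)⁻¹ *ᵥ x, by
      rw [Matrix.mulVec_mulVec, Matrix.mul_nonsing_inv _ hdet, Matrix.one_mulVec]⟩
  rw [Matrix.mulVec_mulVec, Matrix.mul_assoc, Matrix.nonsing_inv_mul _ hdet, Matrix.mul_one,
    one_mul, Matrix.sub_mulVec, Matrix.sub_mulVec, Matrix.smul_mulVec, Matrix.smul_mulVec,
    Matrix.one_mulVec]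
  exact norm_smul_sub_le_norm_sub_smul (u := WithLp.toLp 2 y) (v := WithLp.toLp 2 (L *ᵥ y))
    ((norm_toLp_mulVec_le L y).trans (mul_le_of_le_one_left (norm_nonneg _) hL)) hζ

/-- Resolvent bound for a triangular contraction whose diagonal avoids the reflection of `ζ`. -/
theorem norm_resolvent_le_of_triangular {k : ℕ} {L : Matrix (Fin k) (Fin k) ℂ} (hL : ‖L‖ ≤ 1)
    (ht : ∀ i j, i < j → L i j = 0) {ζ : ℂ} (hζ : ‖ζ‖ ≤ 1) {d : ℝ} (hd : 0 < d)
    (h : ∀ i, d ≤ ‖1 - conj (L i i) * ζ‖) (hne : ∀ i, ζ ≠ L i i) :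
    ‖(ζ • (1 : Matrix (Fin k) (Fin k) ℂ) - L)⁻¹‖ ≤
      ‖toeplitzM k‖ / (d * ‖∏ i, (ζ - L i i) / (1 - conj (L i i) * ζ)‖) := by
  have hconj (i) : ‖1 - conj ζ * L i i‖ = ‖1 - conj (L i i) * ζ‖ := by
    rw [← RCLike.norm_conj]
    simp [mul_comm]
  have hdet : (1 - conj ζ • L).det = ∏ i, (1 - conj ζ * L i i) := by
    rw [← det_smul_one_sub_of_triangular ht, one_smul]
  have hdet' : (ζ • (1 : Matrix (Fin k) (Fin k) ℂ) - L).det = ∏ i, (ζ - L i i) := by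
    simpa using det_smul_one_sub_of_triangular ht ζ 1
  have hu : IsUnit (1 - conj ζ • L).det := by
    rw [hdet, isUnit_iff_ne_zero, Finset.prod_ne_zero_iff]
    intro i _
    rw [← norm_pos_iff, hconj]
    exact hd.trans_le (h i)
  set D := (1 - conj ζ • L)⁻¹ with hD
  set T := (ζ • (1 : Matrix (Fin k) (Fin k) ℂ) - L) * D with hT
  have hTn : ‖T‖ ≤ 1 := norm_mobius_le_one hL hζ hu
  have hTdet : ‖T.det‖ = ‖∏ i, (ζ - L i i) / (1 - conj (L i i) * ζ)‖ := by
    rw [hT, Matrix.det_mul, hD, Matrix.det_nonsing_inv, Ring.inverse_eq_inv', hdet, hdet',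
      ← div_eq_mul_inv, Finset.prod_div_distrib, norm_div, norm_div, norm_prod, norm_prod,
      norm_prod]
    simp_rw [hconj]
  have hT0 : T.det ≠ 0 := by
    rw [← norm_ne_zero_iff, hTdet, norm_ne_zero_iff, Finset.prod_ne_zero_iff]
    intro i _
    exact div_ne_zero (sub_ne_zero.2 (hne i)) (norm_pos_iff.1 (hd.trans_le (h i)))
  have hfac : (ζ • (1 : Matrix (Fin k) (Fin k) ℂ) - L)⁻¹ = D * T⁻¹ := by
    rw [hT, Matrix.mul_inv_rev, ← Matrix.mul_assoc, Matrix.mul_nonsing_inv, Matrix.one_mul]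
    exact Matrix.isUnit_nonsing_inv_det _ hu
  -- ζ̄L is again a triangular contraction, so the Davies–Simon bound applies to it.
  have hDn : ‖D‖ ≤ ‖toeplitzM k‖ / d := by
    refine norm_one_sub_inv_le_of_triangular ?_ (fun i j hij => ?_) hd fun i => ?_
    · rw [norm_smul, RCLike.norm_conj]
      exact mul_le_one₀ hζ (norm_nonneg _) hL
    · simp [ht i j hij]
    · rw [Matrix.smul_apply, smul_eq_mul, hconj]
      exact h i
  rw [hfac, ← hTdet]
  calc ‖D * T⁻¹‖ ≤ ‖D‖ * ‖T⁻¹‖ := Matrix.l2_opNorm_mul _ _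
    _ ≤ ‖toeplitzM k‖ / d * (1 / ‖T.det‖) :=
        mul_le_mul hDn (norm_inv_le_of_norm_le_one hTn hT0) (norm_nonneg _) (by positivity)
    _ = _ := by rw [div_mul_div_comm, mul_one]

/-! ### Reduction to cyclic subspaces and conclusion -/

open Matrix in
/-- A resolvent bound that holds on all triangular compressions to cyclic subspaces holds for the
whole matrix. -/
theorem norm_resolvent_le_of_forall_cyclic {n : ℕ} {A : Matrix (Fin n) (Fin n) ℂ} (hA : ‖A‖ ≤ 1)
    {ζ : ℂ} (hζ : ζ ∉ spectrum ℂ A) {c : ℝ} (hc : 0 ≤ c)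
    (h : ∀ (k : ℕ) (L : Matrix (Fin k) (Fin k) ℂ), ‖L‖ ≤ 1 → (∀ i j, i < j → L i j = 0) →
      L.charpoly ∣ minpoly ℂ A → (∀ i, L i i ∈ spectrum ℂ A) →
      ‖(ζ • (1 : Matrix (Fin k) (Fin k) ℂ) - L)⁻¹‖ ≤ c) :
    ‖(ζ • (1 : Matrix (Fin n) (Fin n) ℂ) - A)⁻¹‖ ≤ c := by
  refine l2_opNorm_le_bound _ hc fun x => ?_
  obtain ⟨k, V, L, y, hV, hAV, rfl, ht, hdvd⟩ := exists_isometry_triangular A x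
  have hmem (i) : L i i ∈ spectrum ℂ A := by
    refine Matrix.mem_spectrum_of_isRoot_charpoly (Polynomial.IsRoot.dvd ?_
      (hdvd.trans (Matrix.minpoly_dvd_charpoly A)))
    rw [charpoly_of_triangular ht, Polynomial.IsRoot.def, Polynomial.eval_prod]
    exact Finset.prod_eq_zero (Finset.mem_univ i) (by simp)
  have hLV : L = Vᴴ * A * V := by
    rw [Matrix.mul_assoc, hAV, ← Matrix.mul_assoc, hV, Matrix.one_mul]
  have hVn := norm_le_one_of_conjTranspose_mul_self hV
  have hL : ‖L‖ ≤ 1 := by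
    rw [hLV]
    calc ‖Vᴴ * A * V‖ ≤ ‖Vᴴ‖ * ‖A‖ * ‖V‖ :=
          (Matrix.l2_opNorm_mul _ _).trans (by gcongr; exact Matrix.l2_opNorm_mul _ _)
      _ ≤ 1 * 1 * 1 := by
          rw [Matrix.l2_opNorm_conjTranspose]
          gcongr
      _ = 1 := by norm_num
  have hdetL : IsUnit (ζ • (1 : Matrix (Fin k) (Fin k) ℂ) - L).det := by
    have h1 := det_smul_one_sub_of_triangular ht ζ 1
    rw [one_smul] at h1
    rw [h1, isUnit_iff_ne_zero, Finset.prod_ne_zero_iff]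
    intro i _ h0
    rw [one_mul, sub_eq_zero] at h0
    exact hζ (h0 ▸ hmem i)
  have hdetA : IsUnit (ζ • (1 : Matrix (Fin n) (Fin n) ℂ) - A).det := by
    rw [← Matrix.isUnit_iff_isUnit_det, ← Algebra.algebraMap_eq_smul_one]
    exact spectrum.notMem_iff.1 hζ
  -- `V` intertwines the resolvents of `A` and `L`; being isometric, it transfers the norm bound at
  -- `x`.
  have hint : (ζ • (1 : Matrix (Fin n) (Fin n) ℂ) - A)⁻¹ * V
      = V * (ζ • (1 : Matrix (Fin k) (Fin k) ℂ) - L)⁻¹ := by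
    have h1 : V * (ζ • (1 : Matrix (Fin k) (Fin k) ℂ) - L)
        = (ζ • (1 : Matrix (Fin n) (Fin n) ℂ) - A) * V := by
      rw [Matrix.mul_sub, Matrix.sub_mul, hAV]
      simp
    calc _ = (ζ • (1 : Matrix (Fin n) (Fin n) ℂ) - A)⁻¹ *
          (V * (ζ • (1 : Matrix (Fin k) (Fin k) ℂ) - L)) *
            (ζ • (1 : Matrix (Fin k) (Fin k) ℂ) - L)⁻¹ := by
          rw [Matrix.mul_assoc, Matrix.mul_assoc, Matrix.mul_nonsing_inv _ hdetL, Matrix.mul_one]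
      _ = _ := by
          rw [h1, ← Matrix.mul_assoc, Matrix.nonsing_inv_mul _ hdetA, Matrix.one_mul]
  rw [Matrix.mulVec_mulVec, hint, ← Matrix.mulVec_mulVec, norm_toLp_isometry_mulVec hV,
    norm_toLp_isometry_mulVec hV]
  refine (norm_toLp_mulVec_le _ _).trans ?_
  gcongr
  exact h k L hL ht hdvd hmem

theorem natDegree_le_of_charpoly_dvd_minpoly {n k : ℕ} {A : Matrix (Fin n) (Fin n) ℂ}
    {L : Matrix (Fin k) (Fin k) ℂ} (h : L.charpoly ∣ minpoly ℂ A) :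
    k ≤ (minpoly ℂ A).natDegree := by
  have := Polynomial.natDegree_le_of_dvd h (minpoly.ne_zero (Algebra.IsIntegral.isIntegral A))
  rwa [Matrix.charpoly_natDegree_eq_dim, Fintype.card_fin] at this

theorem spectrum_sInf_image_pos_and_le {n : ℕ} (hn : 0 < n) (A : Matrix (Fin n) (Fin n) ℂ)
    {f : ℂ → ℝ} (hf : ∀ a ∈ spectrum ℂ A, 0 < f a) :
    0 < sInf (f '' spectrum ℂ A) ∧ ∀ a ∈ spectrum ℂ A, sInf (f '' spectrum ℂ A) ≤ f a := by
  have : Nonempty (Fin n) := ⟨⟨0, hn⟩⟩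
  have hfin : (f '' spectrum ℂ A).Finite := A.finite_spectrum.image f
  have hne : (f '' spectrum ℂ A).Nonempty :=
    (spectrum.nonempty_of_isAlgClosed_of_finiteDimensional ℂ A).image f
  refine ⟨?_, fun a ha => csInf_le hfin.bddBelow ⟨a, ha, rfl⟩⟩
  obtain ⟨a, ha, h⟩ := hne.csInf_mem hfin
  rw [← h]
  exact hf a ha

theorem norm_blaschke_factor_le_one {a z : ℂ} (ha : ‖a‖ ≤ 1) (hz : ‖z‖ ≤ 1) :
    ‖(z - a) / (1 - conj a * z)‖ ≤ 1 := by
  rw [norm_div]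
  refine div_le_one_of_le₀ ?_ (norm_nonneg _)
  have := norm_smul_sub_le_norm_sub_smul (u := (1 : ℂ)) (v := z) (by simpa using hz) ha
  rw [norm_sub_rev]
  simpa using this

/-- Compares the Blaschke product of m with that of a divisor: the extra factors have modulus at
most 1. -/
theorem Multiset.norm_prod_map_le_of_le {α : Type*} {s t : Multiset α} (hst : s ≤ t) (f : α → ℂ)
    (hf : ∀ a ∈ t, ‖f a‖ ≤ 1) : ‖(t.map f).prod‖ ≤ ‖(s.map f).prod‖ := by
  obtain ⟨u, rfl⟩ := Multiset.le_iff_exists_add.1 hst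
  rw [Multiset.map_add, Multiset.prod_add, norm_mul]
  refine mul_le_of_le_one_right (norm_nonneg _) ?_
  have hu : ∀ a ∈ u, ‖f a‖ ≤ 1 := fun a ha => hf a (Multiset.mem_add.2 (Or.inr ha))
  clear hf hst
  induction u using Multiset.induction_on with
  | empty => simp
  | cons a u ih =>
    rw [Multiset.map_cons, Multiset.prod_cons, norm_mul]
    exact mul_le_one₀ (hu a (by simp)) (norm_nonneg _)
      (ih fun b hb => hu b (Multiset.mem_cons_of_mem hb))

theorem mem_spectrum_of_mem_roots_minpoly {n : ℕ} {A : Matrix (Fin n) (Fin n) ℂ} {a : ℂ}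
    (ha : a ∈ (minpoly ℂ A).roots) : a ∈ spectrum ℂ A :=
  Matrix.mem_spectrum_of_isRoot_charpoly
    ((Polynomial.isRoot_of_mem_roots ha).dvd (Matrix.minpoly_dvd_charpoly A))

theorem corollary3 {n : ℕ} (hn : 0 < n) (A : Matrix (Fin n) (Fin n) ℂ) (hA : ‖A‖ ≤ 1) :
    (spectrum ℂ A ⊆ Metric.ball (0 : ℂ) 1 →
      ∀ ζ : ℂ, ζ ∉ spectrum ℂ A → ‖ζ‖ ≤ 1 →
        ‖(ζ • (1 : Matrix (Fin n) (Fin n) ℂ) - A)⁻¹‖ ≤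
          ‖toeplitzM (minpoly ℂ A).natDegree‖ / (minDist A ζ * ‖blaschke A ζ‖)) ∧
    ((1 : ℂ) ∉ spectrum ℂ A →
      ‖((1 : Matrix (Fin n) (Fin n) ℂ) - A)⁻¹‖ ≤
        ‖toeplitzM (minpoly ℂ A).natDegree‖ /
          sInf ((fun a : ℂ => ‖1 - a‖) '' spectrum ℂ A)) := by
  refine ⟨fun hσ ζ hζ hζ1 => ?_, fun h1 => ?_⟩
  · have hσ1 (a) (ha : a ∈ spectrum ℂ A) : ‖a‖ < 1 := by simpa using hσ ha
    -- The open disk matters here: it keeps the denominators nonzero even when |ζ| = 1.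
    have hden (a) (ha : a ∈ spectrum ℂ A) : 1 - conj a * ζ ≠ 0 := fun h0 => by
      have h2 : ‖conj a * ζ‖ = 1 := by rw [← sub_eq_zero.1 h0, norm_one]
      rw [norm_mul, RCLike.norm_conj] at h2
      nlinarith [hσ1 a ha, norm_nonneg a, norm_nonneg ζ]
    obtain ⟨hd, hle⟩ := spectrum_sInf_image_pos_and_le hn A (f := fun a => ‖1 - conj a * ζ‖)
      fun a ha => norm_pos_iff.2 (hden a ha)
    have hB : 0 < ‖blaschke A ζ‖ := by
      rw [norm_pos_iff, blaschke]
      refine Multiset.prod_ne_zero fun h0 => ?_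
      obtain ⟨a, ha, h0⟩ := Multiset.mem_map.1 h0
      have ha' := mem_spectrum_of_mem_roots_minpoly ha
      exact div_ne_zero (sub_ne_zero.2 fun h : ζ = a => hζ (h ▸ ha')) (hden a ha') h0
    refine norm_resolvent_le_of_forall_cyclic hA hζ
      (div_nonneg (norm_nonneg _) (mul_nonneg hd.le hB.le)) fun k L hL ht hdvd hmem => ?_
    refine (norm_resolvent_le_of_triangular hL ht hζ1 hd (fun i => hle _ (hmem i))
      fun i h => hζ (h ▸ hmem i)).trans ?_
    have hBL : ‖blaschke A ζ‖ ≤ ‖∏ i, (ζ - L i i) / (1 - conj (L i i) * ζ)‖ := by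
      have h2 := Multiset.norm_prod_map_le_of_le
        (Polynomial.roots.le_of_dvd (minpoly.ne_zero (Algebra.IsIntegral.isIntegral A)) hdvd)
        (fun a => (ζ - a) / (1 - conj a * ζ)) fun a ha =>
          norm_blaschke_factor_le_one (hσ1 a (mem_spectrum_of_mem_roots_minpoly ha)).le hζ1
      rw [roots_charpoly_of_triangular ht, Multiset.map_map] at h2
      exact h2
    have hk := norm_toeplitzM_mono (natDegree_le_of_charpoly_dvd_minpoly hdvd)
    exact div_le_div₀ (norm_nonneg _) hk (mul_pos hd hB) (mul_le_mul_of_nonneg_left hBL hd.le)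
  · obtain ⟨hd, hle⟩ := spectrum_sInf_image_pos_and_le hn A (f := fun a => ‖1 - a‖)
      fun a ha => norm_pos_iff.2 (sub_ne_zero.2 fun h => h1 (h ▸ ha))
    rw [← one_smul ℂ (1 : Matrix (Fin n) (Fin n) ℂ)]
    refine norm_resolvent_le_of_forall_cyclic hA h1 (div_nonneg (norm_nonneg _) hd.le)
      fun k L hL ht hdvd hmem => ?_
    rw [one_smul]
    exact (norm_one_sub_inv_le_of_triangular hL ht hd fun i => hle _ (hmem i)).trans
      (div_le_div_of_nonneg_right
        (norm_toeplitzM_mono (natDegree_le_of_charpoly_dvd_minpoly hdvd)) hd.le)
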